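/- Let $f(s)=\sum_{n\ge 1}a_n n^{-s}$ be a Dirichlet series with complex coefficients that are multiplicative, i.e. $a_{mn}=a_ma_n$ for all positive integers $m,n$ with $\gcd(m,n)=1$, and suppose that the series converges at some point of $\mathbb{C}$. Let $$\sigma_a(f)=\inf\Big\{\sigma\in\mathbb{R}:\ \sum_{n\ge1}|a_n|n^{-\sigma}<\infty\Big\}\in[-\infty,\infty]$$ be its abscissa of absolute convergence. For $\theta\in\mathbb{R}$, say that $f$ has a bounded analytic continuation to $\operatorname{Re}s\ge\theta$ if there is a function that is analytic (in a neighbourhood of each point) and bounded on this closed half-plane and that equals the sum of the series at every point of it where the series converges. Let $\sigma_0\in\mathbb{R}$ be such that $f$ has a bounded analytic continuation to $\operatorname{Re}s\ge\sigma_0+\varepsilon$ for every $\varepsilon>0$ (with a bound that may depend on $\varepsilon$). Then $\sigma_a(f)\le\sigma_0$. If moreover $\sigma_0$ is the least real number with this property, that is, if $f$ has no bounded analytic continuation to $\operatorname{Re}s\ge\theta$ for any $\theta<\sigma_0$, then $\sigma_a(f)=\sigma_0$. In all cases (including the value $-\infty$), $$\sigma_a(f)=\inf\{\theta\in\mathbb{R}:\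 f\text{ has a bounded analytic continuation to }\operatorname{Re}s\ge\theta\}.$$ -/

import Mathlib

open Filter Topology

/-- The coefficients `a 1, a 2, …` are multiplicative: `a (m * n) = a m * a n` for coprime
positive integers `m`, `n`. (The value `a 0` plays no role.) -/
def MultiplicativeCoeffs (a : ℕ → ℂ) : Prop :=
  ∀ m n : ℕ, 0 < m → 0 < n → m.Coprime n → a (m * n) = a m * a n

/-- The Dirichlet series `∑_{n ≥ 1} a n * n ^ (-s)` converges (possibly only conditionally) at the
point `s`, with sum `l`. The term with index `0` is `0` by definition of `LSeries.term`. -/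
def DirichletConvergesTo (a : ℕ → ℂ) (s l : ℂ) : Prop :=
  Tendsto (fun N : ℕ => ∑ n ∈ Finset.range N, LSeries.term a s n) atTop (𝓝 l)

/-- The Dirichlet series with coefficients `a` has a bounded analytic continuation to the
half-plane `θ ≤ Re s`: there is a function that is analytic and bounded there and that equals the
sum of the series at every point of this half-plane at which the series converges. -/
def HasBoundedContinuation (a : ℕ → ℂ) (θ : ℝ) : Prop :=
  ∃ F : ℂ → ℂ, AnalyticOnNhd ℂ F {s : ℂ | θ ≤ s.re} ∧
    (∃ C : ℝ, ∀ s : ℂ, θ ≤ s.re → ‖F s‖ ≤ C) ∧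
    ∀ s l : ℂ, θ ≤ s.re → DirichletConvergesTo a s l → F s = l

/-- The abscissa of boundedness: the infimum, in the extended reals, of all real `θ` such that the
series has a bounded analytic continuation to `θ ≤ Re s`. -/
noncomputable def abscissaOfBoundedness (a : ℕ → ℂ) : EReal :=
  sInf (Real.toEReal '' {θ : ℝ | HasBoundedContinuation a θ})

/-- The mean value of `h` over the segment `Re s = c`, `|Im s| ≤ T`. -/
noncomputable def verticalMean (h : ℂ → ℂ) (c T : ℝ) : ℂ :=
  ((2 * T : ℝ) : ℂ)⁻¹ * ∫ t in (-T)..T, h (c + t * Complex.I)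

lemma continuous_verticalLine (c : ℝ) : Continuous fun t : ℝ => (c : ℂ) + t * Complex.I := by
  fun_prop

lemma norm_verticalMean_le {h : ℂ → ℂ} {c T B : ℝ} (hT : 0 < T)
    (hB : ∀ t : ℝ, ‖h (c + t * Complex.I)‖ ≤ B) : ‖verticalMean h c T‖ ≤ B := by
  have h1 : ‖∫ t in (-T)..T, h (c + t * Complex.I)‖ ≤ B * |T - (-T)| :=
    intervalIntegral.norm_integral_le_of_norm_le_const fun t _ => hB t
  rw [abs_of_pos (by linarith)] at h1
  rw [verticalMean, norm_mul, norm_inv, Complex.norm_real, Real.norm_of_nonneg (by linarith),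
    inv_mul_le_iff₀ (by linarith)]
  linarith

lemma tendsto_verticalMean_exp (l c : ℝ) :
    Tendsto (verticalMean (fun s => Complex.exp (s * l)) c) atTop
      (𝓝 (if l = 0 then 1 else 0)) := by
  split_ifs with hl
  · refine tendsto_const_nhds.congr' ?_
    filter_upwards [eventually_gt_atTop 0] with T hT
    have : (T : ℂ) ≠ 0 := by exact_mod_cast hT.ne'
    simp only [verticalMean, hl, Complex.ofReal_zero, mul_zero, Complex.exp_zero,
      intervalIntegral.integral_const, Complex.real_smul]
    push_cast
    field_simp
    ring
  · have hl' : (Complex.I * l : ℂ) ≠ 0 := by simp [hl]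
    have key : ∀ T : ℝ, 0 < T → ‖verticalMean (fun s => Complex.exp (s * l)) c T‖ ≤
        T⁻¹ * (Real.exp (c * l) / |l|) := by
      intro T hT
      have : ∀ t : ℝ, Complex.exp (((c : ℂ) + t * Complex.I) * l) =
          Complex.exp (c * l) * Complex.exp (Complex.I * l * t) := by
        intro t
        rw [← Complex.exp_add]
        ring_nf
      have hn : ∀ t : ℝ, ‖Complex.exp (Complex.I * l * t)‖ = 1 := by
        intro t
        rw [Complex.norm_exp]
        simp
      simp only [verticalMean, this, intervalIntegral.integral_const_mul]
      rw [integral_exp_mul_complex hl', norm_mul, norm_mul, norm_div, norm_inv, Complex.norm_real,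
        Real.norm_of_nonneg (by linarith), Complex.norm_exp]
      have h2 := norm_sub_le (Complex.exp (Complex.I * l * (T : ℝ)))
        (Complex.exp (Complex.I * l * ((-T : ℝ) : ℂ)))
      rw [hn, hn] at h2
      have h3 : ‖Complex.I * (l : ℂ)‖ = |l| := by simp
      have h4 : ((c : ℂ) * l).re = c * l := by simp
      rw [h3, h4]
      have : 0 < |l| := abs_pos.mpr hl
      calc (2 * T)⁻¹ * (Real.exp (c * l) * (_ / |l|))
          ≤ (2 * T)⁻¹ * (Real.exp (c * l) * ((1 + 1) / |l|)) := by gcongr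
        _ = _ := by field_simp; ring
    refine squeeze_zero_norm' (a := fun T => T⁻¹ * (Real.exp (c * l) / |l|)) ?_ ?_
    · filter_upwards [eventually_gt_atTop 0] with T hT using key T hT
    · simpa using tendsto_inv_atTop_zero.mul_const (Real.exp (c * l) / |l|)

lemma verticalMean_congr {h g : ℂ → ℂ} {c : ℝ} (hg : ∀ t : ℝ, h (c + t * Complex.I) =
    g (c + t * Complex.I)) : verticalMean h c = verticalMean g c := by
  funext T
  simp only [verticalMean, hg]

lemma verticalMean_const_mul (h : ℂ → ℂ) (k : ℂ) (c T : ℝ) :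
    verticalMean (fun s => k * h s) c T = k * verticalMean h c T := by
  simp only [verticalMean, intervalIntegral.integral_const_mul]
  ring

lemma verticalMean_finset_sum {ι : Type*} (S : Finset ι) (h : ι → ℂ → ℂ) (c T : ℝ)
    (hc : ∀ i ∈ S, Continuous fun t : ℝ => h i (c + t * Complex.I)) :
    verticalMean (fun s => ∑ i ∈ S, h i s) c T = ∑ i ∈ S, verticalMean (h i) c T := by
  simp only [verticalMean]
  rw [intervalIntegral.integral_finsetSum fun i hi => (hc i hi).intervalIntegrable _ _,
    Finset.mul_sum]

/-- Termwise passage to the limit in the vertical mean of a normally convergent series. -/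
lemma tendsto_verticalMean_tsum {g : ℕ → ℂ → ℂ} {c : ℝ} {b : ℕ → ℝ} {L : ℕ → ℂ}
    (hc : ∀ n, Continuous fun t : ℝ => g n (c + t * Complex.I)) (hb : Summable b)
    (hgb : ∀ n (t : ℝ), ‖g n (c + t * Complex.I)‖ ≤ b n)
    (hL : ∀ n, Tendsto (verticalMean (g n) c) atTop (𝓝 (L n))) :
    Tendsto (verticalMean (fun s => ∑' n, g n s) c) atTop (𝓝 (∑' n, L n)) := by
  have h1 : ∀ T, verticalMean (fun s => ∑' n, g n s) c T = ∑' n, verticalMean (g n) c T := by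
    intro T
    simp only [verticalMean]
    rw [tsum_mul_left]
    congr 1
    refine (intervalIntegral.hasSum_integral_of_dominated_convergence (fun n _ => b n)
      (fun n => (hc n).aestronglyMeasurable) (fun n => ?_) ?_ ?_ ?_).tsum_eq.symm
    · exact Eventually.of_forall fun t _ => hgb n t
    · exact Eventually.of_forall fun t _ => hb
    · exact continuous_const.intervalIntegrable _ _
    · exact Eventually.of_forall fun t _ =>
        (Summable.of_norm_bounded hb fun n => hgb n t).hasSum
  rw [show verticalMean (fun s => ∑' n, g n s) c = fun T => ∑' n, verticalMean (g n) c T from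
    funext h1]
  refine tendsto_tsum_of_dominated_convergence hb hL ?_
  filter_upwards [eventually_gt_atTop 0] with T hT n
  exact norm_verticalMean_le hT (hgb n)

lemma continuous_cpow_verticalLine {u : ℕ} (hu : 0 < u) (c : ℝ) :
    Continuous fun t : ℝ => (u : ℂ) ^ ((c : ℂ) + t * Complex.I) :=
  (continuous_verticalLine c).const_cpow (Or.inl (by exact_mod_cast hu.ne'))

lemma continuous_cpow_neg_verticalLine {u : ℕ} (hu : 0 < u) (c : ℝ) :
    Continuous fun t : ℝ => (u : ℂ) ^ (-((c : ℂ) + t * Complex.I)) :=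
  (continuous_verticalLine c).neg.const_cpow (Or.inl (by exact_mod_cast hu.ne'))

lemma natCast_cpow_eq_exp {u : ℕ} (hu : 0 < u) (s : ℂ) :
    (u : ℂ) ^ s = Complex.exp (s * (Real.log u : ℝ)) := by
  rw [Complex.cpow_def_of_ne_zero (by exact_mod_cast hu.ne'), Complex.natCast_log, mul_comm]

/-- The vertical mean of a Dirichlet series against `(u / v) ^ s` is its coefficient at `u / v`. -/
lemma tendsto_verticalMean_LSeries {a : ℕ → ℂ} {c : ℝ} (hs : LSeriesSummable a c) {u v : ℕ}
    (hu : 0 < u) (hv : 0 < v) :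
    Tendsto (verticalMean (fun s => LSeries a s * ((u : ℂ) ^ s * (v : ℂ) ^ (-s))) c) atTop
      (𝓝 (if v ∣ u then a (u / v) else 0)) := by
  let g : ℕ → ℂ → ℂ := fun n s => LSeries.term a s n * ((u : ℂ) ^ s * (v : ℂ) ^ (-s))
  let L : ℕ → ℂ := fun n => if n * v = u then a n else 0
  have hgeq : ∀ n, 0 < n → ∀ s, g n s =
      a n * Complex.exp (s * ((Real.log u - Real.log v - Real.log n : ℝ))) := by
    intro n hn s
    simp only [g, LSeries.term_def, if_neg hn.ne', natCast_cpow_eq_exp hu,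
      natCast_cpow_eq_exp hv, natCast_cpow_eq_exp hn]
    rw [div_eq_mul_inv, ← Complex.exp_neg, mul_assoc, ← Complex.exp_add, ← Complex.exp_add]
    push_cast
    ring_nf
  have hg0 : ∀ s, g 0 s = 0 := fun s => by simp [g]
  have key := tendsto_verticalMean_tsum (g := g) (c := c) (L := L)
    (b := fun n => ‖LSeries.term a c n‖ * ((u : ℝ) ^ c * (v : ℝ) ^ (-c))) ?_ ?_ ?_ ?_
  · have h1 : verticalMean (fun s => LSeries a s * ((u : ℂ) ^ s * (v : ℂ) ^ (-s))) c =
        verticalMean (fun s => ∑' n, g n s) c :=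
      verticalMean_congr fun t => by simp only [g, LSeries, tsum_mul_right]
    have h2 : ∑' n, L n = if v ∣ u then a (u / v) else 0 := by
      rw [tsum_eq_single (u / v)]
      · simp only [L]
        by_cases h : v ∣ u
        · rw [if_pos h, if_pos (Nat.div_mul_cancel h)]
        · rw [if_neg h, if_neg fun h' => h ⟨_, by rw [mul_comm]; exact h'.symm⟩]
      · intro n hn
        simp only [L]
        rw [if_neg]
        rintro rfl
        exact hn (Nat.mul_div_cancel _ hv).symm
    rwa [h1, ← h2]
  · intro n
    rcases Nat.eq_zero_or_pos n with rfl | hn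
    · simpa only [hg0] using continuous_const
    · simp only [hgeq n hn]
      fun_prop
  · exact hs.norm.mul_right _
  · intro n t
    simp only [g]
    rw [norm_mul, norm_mul, Complex.norm_natCast_cpow_of_pos hu,
      Complex.norm_natCast_cpow_of_pos hv, LSeries.norm_term_eq, LSeries.norm_term_eq]
    simp
  · intro n
    rcases Nat.eq_zero_or_pos n with rfl | hn
    · have : L 0 = 0 := by simp [L, hu.ne]
      rw [this, show verticalMean (g 0) c = fun _ => 0 by funext T; simp [verticalMean, hg0]]
      exact tendsto_const_nhds
    · have h1 : verticalMean (g n) c = fun T => a n * verticalMean (fun s =>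
          Complex.exp (s * ((Real.log u - Real.log v - Real.log n : ℝ)))) c T := by
        funext T
        rw [← verticalMean_const_mul]
        exact congrFun (verticalMean_congr fun t => hgeq n hn _) T
      have h2 : (Real.log u - Real.log v - Real.log n = 0) ↔ n * v = u := by
        have hu' : (0 : ℝ) < u := by exact_mod_cast hu
        have hv' : (0 : ℝ) < v := by exact_mod_cast hv
        have hn' : (0 : ℝ) < n := by exact_mod_cast hn
        rw [sub_sub, ← Real.log_mul hv'.ne' hn'.ne', sub_eq_zero]
        constructor
        · intro h
          have := Real.log_injOn_pos hu' (mul_pos hv' hn') h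
          rw [mul_comm]
          exact_mod_cast this.symm
        · rintro rfl
          push_cast
          rw [mul_comm]
      have h3 := (tendsto_verticalMean_exp (Real.log u - Real.log v - Real.log n) c).const_mul (a n)
      simp only [h2] at h3
      rw [h1]
      simpa [L, mul_ite] using h3

/-- If `h` is holomorphic and bounded in the strip `c ≤ Re s ≤ d`, then its vertical means
over the two boundary lines are asymptotically equal. -/
lemma tendsto_verticalMean_sub {h : ℂ → ℂ} {c d B : ℝ} (hcd : c ≤ d)
    (hd : ∀ s : ℂ, c ≤ s.re → s.re ≤ d → DifferentiableAt ℂ h s)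
    (hB : ∀ s : ℂ, c ≤ s.re → s.re ≤ d → ‖h s‖ ≤ B) :
    Tendsto (fun T => verticalMean h d T - verticalMean h c T) atTop (𝓝 0) := by
  have key : ∀ T : ℝ, 0 < T → ‖verticalMean h d T - verticalMean h c T‖ ≤
      T⁻¹ * (B * (d - c)) := by
    intro T hT
    have h0 := Complex.integral_boundary_rect_eq_zero_of_differentiableOn h
      (c + (-T : ℝ) * Complex.I) (d + T * Complex.I) (by
        intro s hs
        rw [Complex.mem_reProdIm] at hs
        simp only [Complex.add_re, Complex.ofReal_re, Complex.mul_re, Complex.I_re, mul_zero,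
          Complex.ofReal_im, Complex.I_im, mul_one, sub_self, add_zero, Set.uIcc_of_le hcd,
          Set.mem_Icc] at hs
        exact (hd s hs.1.1 hs.1.2).differentiableWithinAt)
    simp only [Complex.add_re, Complex.ofReal_re, Complex.mul_re, Complex.I_re, mul_zero,
          Complex.ofReal_im, Complex.I_im, mul_one, sub_self, add_zero, Complex.add_im,
          Complex.mul_im, zero_add, smul_eq_mul] at h0
    have hside : ∀ y : ℝ, ‖∫ x in c..d, h (x + y * Complex.I)‖ ≤ B * (d - c) := by
      intro y
      have := intervalIntegral.norm_integral_le_of_norm_le_const (a := c) (b := d) (C := B)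
        (f := fun x : ℝ => h (x + y * Complex.I)) (fun x hx => by
          rw [Set.uIoc_of_le hcd] at hx
          exact hB _ (by simpa using hx.1.le) (by simpa using hx.2))
      rwa [abs_of_nonneg (by linarith)] at this
    set J1 := ∫ x in c..d, h (x + (-T : ℝ) * Complex.I) with hJ1
    set J2 := ∫ x in c..d, h (x + T * Complex.I) with hJ2
    have h1 : verticalMean h d T - verticalMean h c T =
        ((2 * T : ℝ) : ℂ)⁻¹ * (Complex.I * (J1 - J2)) := by
      simp only [verticalMean]
      rw [← mul_sub]
      congr 1
      linear_combination (-Complex.I) * h0 +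
        (-(∫ y in (-T)..T, h (d + y * Complex.I)) + ∫ y in (-T)..T, h (c + y * Complex.I)) *
          (-Complex.I_mul_I)
    rw [h1, norm_mul, norm_mul, norm_inv, Complex.norm_real, Real.norm_of_nonneg (by linarith),
      Complex.norm_I, one_mul]
    have h2 : ‖J1 - J2‖ ≤ 2 * (B * (d - c)) :=
      (norm_sub_le _ _).trans (by linarith [hside (-T), hside T])
    calc (2 * T)⁻¹ * ‖J1 - J2‖ ≤ (2 * T)⁻¹ * (2 * (B * (d - c))) := by gcongr
      _ = _ := by field_simp
  refine squeeze_zero_norm' (a := fun T => T⁻¹ * (B * (d - c))) ?_ ?_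
  · filter_upwards [eventually_gt_atTop 0] with T hT using key T hT
  · simpa using tendsto_inv_atTop_zero.mul_const (B * (d - c))

/-- A generalised Riesz product with frequencies `log q`, `q ∈ S`. -/
noncomputable def rieszProduct (S : Finset ℕ) (x y : ℕ → ℂ) (s : ℂ) : ℂ :=
  ∏ q ∈ S, (1 + x q * (q : ℂ) ^ s + y q * (q : ℂ) ^ (-s))

lemma natCast_prod_cpow (A : Finset ℕ) (s : ℂ) :
    ((∏ q ∈ A, q : ℕ) : ℂ) ^ s = ∏ q ∈ A, (q : ℂ) ^ s := by
  induction A using Finset.induction_on with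
  | empty => simp
  | insert q A hq ih =>
    rw [Finset.prod_insert hq, Finset.prod_insert hq, Nat.cast_mul,
      Complex.natCast_mul_natCast_cpow, ih]

lemma rieszProduct_eq_sum (S : Finset ℕ) (x y : ℕ → ℂ) (s : ℂ) :
    rieszProduct S x y s = ∑ A ∈ S.powerset, ∑ B ∈ (S \ A).powerset,
      ((∏ q ∈ A, x q) * ∏ q ∈ B, y q) *
        (((∏ q ∈ A, q : ℕ) : ℂ) ^ s * ((∏ q ∈ B, q : ℕ) : ℂ) ^ (-s)) := by
  simp only [rieszProduct]
  rw [Finset.prod_congr rfl (g := fun q => x q * (q : ℂ) ^ s + (1 + y q * (q : ℂ) ^ (-s)))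
    (fun q _ => by ring), Finset.prod_add]
  refine Finset.sum_congr rfl fun A _ => ?_
  rw [Finset.prod_one_add, Finset.mul_sum]
  refine Finset.sum_congr rfl fun B _ => ?_
  rw [Finset.prod_mul_distrib, Finset.prod_mul_distrib, natCast_prod_cpow, natCast_prod_cpow]
  ring

lemma MultiplicativeCoeffs.map_prod {a : ℕ → ℂ} (ha : MultiplicativeCoeffs a) (h1 : a 1 = 1)
    {A : Finset ℕ} (hA : ∀ q ∈ A, 1 < q) (hco : (A : Set ℕ).Pairwise Nat.Coprime) :
    a (∏ q ∈ A, q) = ∏ q ∈ A, a q := by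
  induction A using Finset.induction_on with
  | empty => simpa using h1
  | insert q A hq ih =>
    rw [Finset.prod_insert hq, Finset.prod_insert hq, ha, ih]
    · exact fun r hr => hA r (Finset.mem_insert_of_mem hr)
    · exact hco.mono (by simp)
    · exact zero_lt_one.trans (hA q (Finset.mem_insert_self _ _))
    · exact Finset.prod_pos fun r hr => zero_lt_one.trans (hA r (Finset.mem_insert_of_mem hr))
    · refine Nat.Coprime.prod_right fun r hr => hco (by simp) (by simp [hr]) ?_
      rintro rfl
      exact hq hr

/-- The vertical mean of a Dirichlet series with multiplicative coefficients against a Riesz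
product factors. -/
lemma tendsto_verticalMean_rieszProduct {a : ℕ → ℂ} (ha : MultiplicativeCoeffs a)
    (h1 : a 1 = 1) {c : ℝ} (hs : LSeriesSummable a c) {S : Finset ℕ} (hS : ∀ q ∈ S, 1 < q)
    (hco : (S : Set ℕ).Pairwise Nat.Coprime) (x y : ℕ → ℂ) :
    Tendsto (verticalMean (fun s => LSeries a s * rieszProduct S x y s) c) atTop
      (𝓝 (∏ q ∈ S, (1 + x q * a q))) := by
  have hpos : ∀ A ⊆ S, 0 < ∏ q ∈ A, q := fun A hA =>
    Finset.prod_pos fun q hq => zero_lt_one.trans (hS q (hA hq))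
  have hcont : Continuous fun t : ℝ => LSeries a (c + t * Complex.I) := by
    refine continuous_tsum (u := fun n => ‖LSeries.term a c n‖) (fun n => ?_) hs.norm ?_
    · rcases Nat.eq_zero_or_pos n with rfl | hn
      · simpa using continuous_const
      · simp only [LSeries.term_def, if_neg hn.ne']
        refine continuous_const.div (continuous_cpow_verticalLine hn c) fun t => ?_
        rw [natCast_cpow_eq_exp hn]
        exact Complex.exp_ne_zero _
    · intro n t
      exact LSeries.norm_term_le_of_re_le_re a (by simp) n
  let k : Finset ℕ → Finset ℕ → ℂ := fun A B => (∏ q ∈ A, x q) * ∏ q ∈ B, y q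
  let g : Finset ℕ → Finset ℕ → ℂ → ℂ := fun A B s => LSeries a s *
    (((∏ q ∈ A, q : ℕ) : ℂ) ^ s * ((∏ q ∈ B, q : ℕ) : ℂ) ^ (-s))
  have hg : ∀ A ⊆ S, ∀ B ⊆ S, Continuous fun t : ℝ => g A B (c + t * Complex.I) :=
    fun A hA B hB => hcont.mul ((continuous_cpow_verticalLine (hpos A hA) c).mul
      (continuous_cpow_neg_verticalLine (hpos B hB) c))
  have hexp : verticalMean (fun s => LSeries a s * rieszProduct S x y s) c = fun T =>
      ∑ A ∈ S.powerset, ∑ B ∈ (S \ A).powerset, k A B * verticalMean (g A B) c T := by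
    have e1 : (fun s => LSeries a s * rieszProduct S x y s) = fun s =>
        ∑ A ∈ S.powerset, ∑ B ∈ (S \ A).powerset, k A B * g A B s := by
      funext s
      rw [rieszProduct_eq_sum, Finset.mul_sum]
      refine Finset.sum_congr rfl fun A _ => ?_
      rw [Finset.mul_sum]
      refine Finset.sum_congr rfl fun B _ => ?_
      simp only [k, g]
      ring
    have hsub : ∀ A B, B ∈ (S \ A).powerset → B ⊆ S := fun A B hB =>
      (Finset.mem_powerset.mp hB).trans Finset.sdiff_subset
    funext T
    rw [e1, verticalMean_finset_sum]
    · refine Finset.sum_congr rfl fun A hA => ?_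
      rw [verticalMean_finset_sum]
      · exact Finset.sum_congr rfl fun B _ => verticalMean_const_mul _ _ _ _
      · exact fun B hB => continuous_const.mul
          (hg A (Finset.mem_powerset.mp hA) B (hsub A B hB))
    · exact fun A hA => continuous_finsetSum _ fun B hB => continuous_const.mul
        (hg A (Finset.mem_powerset.mp hA) B (hsub A B hB))
  have hlim : ∏ q ∈ S, (1 + x q * a q) =
      ∑ A ∈ S.powerset, ∑ B ∈ (S \ A).powerset, k A B *
        (if (∏ q ∈ B, q) ∣ (∏ q ∈ A, q) then a ((∏ q ∈ A, q) / (∏ q ∈ B, q)) else 0) := by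
    rw [Finset.prod_one_add]
    refine Finset.sum_congr rfl fun A hA => ?_
    have hA' := Finset.mem_powerset.mp hA
    rw [Finset.sum_eq_single_of_mem ∅ (by simp)]
    · rw [Finset.prod_mul_distrib, ← ha.map_prod h1 (fun q hq => hS q (hA' hq))
        (hco.mono (by exact_mod_cast hA'))]
      simp [k]
    · intro B hB hne
      obtain ⟨q, hq⟩ := Finset.nonempty_iff_ne_empty.mpr hne
      have hqS := Finset.mem_sdiff.mp (Finset.mem_powerset.mp hB hq)
      rw [if_neg, mul_zero]
      intro hdvd
      have h2 : q ∣ ∏ r ∈ A, r := (Finset.dvd_prod_of_mem _ hq).trans hdvd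
      have h3 : Nat.Coprime q (∏ r ∈ A, r) := Nat.Coprime.prod_right fun r hr =>
        hco hqS.1 (hA' hr) (by rintro rfl; exact hqS.2 hr)
      exact (hS q hqS.1).ne' (Nat.Coprime.eq_one_of_dvd h3 h2)
  rw [hexp, hlim]
  refine tendsto_finsetSum _ fun A hA => tendsto_finsetSum _ fun B hB => ?_
  exact (tendsto_verticalMean_LSeries hs (hpos A (Finset.mem_powerset.mp hA)) (hpos B
    ((Finset.mem_powerset.mp hB).trans Finset.sdiff_subset))).const_mul _

lemma differentiable_rieszProduct {S : Finset ℕ} (hS : ∀ q ∈ S, 1 < q) (x y : ℕ → ℂ) :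
    Differentiable ℂ (rieszProduct S x y) := by
  have : ∀ q ∈ S, Differentiable ℂ
      fun s : ℂ => 1 + x q * (q : ℂ) ^ s + y q * (q : ℂ) ^ (-s) := by
    intro q hq
    have h0 := zero_lt_one.trans (hS q hq)
    simp only [natCast_cpow_eq_exp h0]
    fun_prop
  unfold rieszProduct
  exact Differentiable.fun_finsetProd this

lemma norm_rieszProduct_le {S : Finset ℕ} (hS : ∀ q ∈ S, 1 < q) (x y : ℕ → ℂ) {c d : ℝ}
    {s : ℂ} (hc : c ≤ s.re) (hd : s.re ≤ d) :
    ‖rieszProduct S x y s‖ ≤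
      ∏ q ∈ S, (1 + ‖x q‖ * (q : ℝ) ^ d + ‖y q‖ * (q : ℝ) ^ (-c)) := by
  rw [rieszProduct, norm_prod]
  refine Finset.prod_le_prod (fun _ _ => norm_nonneg _) fun q hq => ?_
  have h0 := zero_lt_one.trans (hS q hq)
  have h1 : (1 : ℝ) ≤ q := by exact_mod_cast (hS q hq).le
  refine (norm_add_le _ _).trans (add_le_add ((norm_add_le _ _).trans ?_) ?_)
  · rw [norm_one, norm_mul, Complex.norm_natCast_cpow_of_pos h0]
    gcongr
  · rw [norm_mul, Complex.norm_natCast_cpow_of_pos h0, Complex.neg_re]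
    gcongr

/-- The Riesz product is nonnegative on the line `Re s = c` for suitably normalised
coefficients. -/
lemma rieszProduct_eq_norm {S : Finset ℕ} (hS : ∀ q ∈ S, 1 < q) {w : ℕ → ℂ}
    (hw : ∀ q, ‖w q‖ ≤ 1) (c t : ℝ) :
    rieszProduct S (fun q => w q / 2 * (q : ℂ) ^ (-(c : ℂ)))
      (fun q => starRingEnd ℂ (w q) / 2 * (q : ℂ) ^ (c : ℂ)) (c + t * Complex.I) =
    (‖rieszProduct S (fun q => w q / 2 * (q : ℂ) ^ (-(c : ℂ)))
      (fun q => starRingEnd ℂ (w q) / 2 * (q : ℂ) ^ (c : ℂ)) (c + t * Complex.I)‖ : ℂ) := by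
  suffices h : ∃ r : ℝ, 0 ≤ r ∧
      rieszProduct S (fun q => w q / 2 * (q : ℂ) ^ (-(c : ℂ)))
        (fun q => starRingEnd ℂ (w q) / 2 * (q : ℂ) ^ (c : ℂ)) (c + t * Complex.I) = r by
    obtain ⟨r, hr, h⟩ := h
    rw [h, Complex.norm_real, Real.norm_of_nonneg hr]
  refine ⟨∏ q ∈ S, (1 + (w q * Complex.exp ((t * Real.log q : ℝ) * Complex.I)).re),
    Finset.prod_nonneg fun q hq => ?_, ?_⟩
  · have h1 := Complex.abs_re_le_norm (w q * Complex.exp ((t * Real.log q : ℝ) * Complex.I))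
    rw [norm_mul, Complex.norm_exp_ofReal_mul_I, mul_one] at h1
    linarith [hw q, (abs_le.mp h1).1]
  · rw [rieszProduct, Complex.ofReal_prod]
    refine Finset.prod_congr rfl fun q hq => ?_
    have h0 := zero_lt_one.trans (hS q hq)
    rw [Complex.ofReal_add, Complex.ofReal_one, Complex.re_eq_add_conj, map_mul,
      ← Complex.exp_conj, natCast_cpow_eq_exp h0, natCast_cpow_eq_exp h0,
      natCast_cpow_eq_exp h0, natCast_cpow_eq_exp h0, mul_assoc (w q / 2), ← Complex.exp_add,
      mul_assoc (_ / 2), ← Complex.exp_add, map_mul, Complex.conj_I, Complex.conj_ofReal]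
    push_cast
    ring_nf

lemma LSeries_eq_of_convergesTo {a : ℕ → ℂ} {F : ℂ → ℂ} {θ : ℝ} {s : ℂ}
    (hF : ∀ s l : ℂ, θ ≤ s.re → DirichletConvergesTo a s l → F s = l)
    (hθ : θ ≤ s.re) (hs : LSeriesSummable a s) : F s = LSeries a s :=
  hF s _ hθ hs.hasSum.tendsto_sum_nat

lemma multiplicativeCoeffs_delta : MultiplicativeCoeffs LSeries.delta := by
  intro m n _ _ _
  simp only [LSeries.delta, mul_eq_one]
  split_ifs <;> simp_all

/-- A bound for the continuation of a Dirichlet series with multiplicative coefficients bounds a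
product over pairwise coprime indices. -/
lemma prod_one_add_norm_le {a : ℕ → ℂ} (ha : MultiplicativeCoeffs a) (h1 : a 1 = 1)
    {F : ℂ → ℂ} {θ d C : ℝ} (han : AnalyticOnNhd ℂ F {s : ℂ | θ ≤ s.re})
    (hC : ∀ s : ℂ, θ ≤ s.re → ‖F s‖ ≤ C)
    (hF : ∀ s l : ℂ, θ ≤ s.re → DirichletConvergesTo a s l → F s = l) (hd : θ ≤ d)
    (hs : LSeriesSummable a d) {S : Finset ℕ} (hS : ∀ q ∈ S, 1 < q)
    (hco : (S : Set ℕ).Pairwise Nat.Coprime) :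
    ∏ q ∈ S, (1 + ‖a q‖ * (q : ℝ) ^ (-θ) / 2) ≤ C := by
  let w : ℕ → ℂ := fun q => starRingEnd ℂ (a q) / ‖a q‖
  have hw : ∀ q, ‖w q‖ ≤ 1 := fun q => by
    simp only [w, norm_div, RCLike.norm_conj, Complex.norm_real, norm_norm]
    exact div_self_le_one _
  have hwa : ∀ q, w q * a q = ‖a q‖ := fun q => by
    simp only [w]
    rcases eq_or_ne (a q) 0 with h | h
    · simp [h]
    · have : (‖a q‖ : ℂ) ≠ 0 := by exact_mod_cast norm_ne_zero_iff.mpr h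
      rw [div_mul_eq_mul_div, mul_comm, Complex.mul_conj']
      field_simp
  set x : ℕ → ℂ := fun q => w q / 2 * (q : ℂ) ^ (-(θ : ℂ)) with hx
  set y : ℕ → ℂ := fun q => starRingEnd ℂ (w q) / 2 * (q : ℂ) ^ (θ : ℂ) with hy
  have hP : ∀ t : ℝ, rieszProduct S x y (θ + t * Complex.I) =
      (‖rieszProduct S x y (θ + t * Complex.I)‖ : ℂ) := rieszProduct_eq_norm hS hw θ
  have hC0 : 0 ≤ C := (norm_nonneg _).trans (hC θ (by simp))
  -- the mean of `F` times the Riesz product, moved from the line `d` to the line `θ`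
  have hmean : Tendsto (verticalMean (fun s => F s * rieszProduct S x y s) θ) atTop
      (𝓝 (∏ q ∈ S, (1 + x q * a q))) := by
    have hd1 : Tendsto (verticalMean (fun s => F s * rieszProduct S x y s) d) atTop
        (𝓝 (∏ q ∈ S, (1 + x q * a q))) := by
      rw [verticalMean_congr (g := fun s => LSeries a s * rieszProduct S x y s) fun t => ?_]
      · exact tendsto_verticalMean_rieszProduct ha h1 hs hS hco x y
      · rw [LSeries_eq_of_convergesTo hF (by simpa using hd)
          (hs.of_re_le_re (by simp))]
    have hsub := tendsto_verticalMean_sub (h := fun s => F s * rieszProduct S x y s) (c := θ)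
      (B := C * ∏ q ∈ S, (1 + ‖x q‖ * (q : ℝ) ^ d + ‖y q‖ * (q : ℝ) ^ (-θ))) hd
      (fun s h _ => (han s h).differentiableAt.mul (differentiable_rieszProduct hS x y s))
      (fun s h h' => by
        rw [norm_mul]
        exact mul_le_mul (hC s h) (norm_rieszProduct_le hS x y h h') (norm_nonneg _) hC0)
    simpa using hd1.sub hsub
  have hone : Tendsto (verticalMean (rieszProduct S x y) θ) atTop (𝓝 1) := by
    have hsd : LSeriesSummable LSeries.delta (θ : ℂ) :=
      summable_of_hasFiniteSupport ((Set.finite_singleton 1).subset fun n hn => by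
        rw [Function.mem_support, LSeries.term_delta] at hn
        simpa using hn)
    have := tendsto_verticalMean_rieszProduct multiplicativeCoeffs_delta (by simp [LSeries.delta])
      hsd hS hco x y
    rw [Finset.prod_eq_one fun q hq => by simp [LSeries.delta, (hS q hq).ne']] at this
    simpa [LSeries_delta] using this
  have hle : ∀ᶠ T in atTop, ‖verticalMean (fun s => F s * rieszProduct S x y s) θ T‖ ≤
      C * ‖verticalMean (rieszProduct S x y) θ T‖ := by
    filter_upwards [eventually_gt_atTop 0] with T hT
    have hcont : Continuous fun t : ℝ => rieszProduct S x y (θ + t * Complex.I) :=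
      (differentiable_rieszProduct hS x y).continuous.comp (continuous_verticalLine θ)
    have h2 : ‖∫ t in (-T)..T, rieszProduct S x y (θ + t * Complex.I)‖ =
        ∫ t in (-T)..T, ‖rieszProduct S x y (θ + t * Complex.I)‖ := by
      rw [intervalIntegral.integral_congr (g := fun t : ℝ =>
        (‖rieszProduct S x y (θ + t * Complex.I)‖ : ℂ)) fun t _ => hP t,
        intervalIntegral.integral_ofReal, Complex.norm_real, Real.norm_of_nonneg]
      exact intervalIntegral.integral_nonneg (by linarith) fun t _ => norm_nonneg _
    simp only [verticalMean]
    rw [norm_mul, norm_mul, h2, mul_left_comm]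
    refine mul_le_mul_of_nonneg_left ?_ (norm_nonneg _)
    rw [← intervalIntegral.integral_const_mul]
    refine intervalIntegral.norm_integral_le_of_norm_le (by linarith) (Eventually.of_forall
      fun t _ => ?_) ((continuous_const.mul hcont.norm).intervalIntegrable _ _)
    rw [norm_mul]
    exact mul_le_mul_of_nonneg_right (hC _ (by simp)) (norm_nonneg _)
  have hfin := le_of_tendsto_of_tendsto hmean.norm (hone.norm.const_mul C) hle
  rw [norm_one, mul_one] at hfin
  refine le_of_eq_of_le ?_ hfin
  rw [norm_prod]
  refine Finset.prod_congr rfl fun q hq => ?_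
  have h0 := zero_lt_one.trans (hS q hq)
  have h3 : (1 + x q * a q : ℂ) = ((1 + ‖a q‖ * (q : ℝ) ^ (-θ) / 2 : ℝ) : ℂ) := by
    push_cast
    rw [← hwa, Complex.ofReal_cpow (Nat.cast_nonneg q)]
    simp only [hx]
    push_cast
    ring
  rw [h3, Complex.norm_real, Real.norm_of_nonneg (by positivity)]

lemma sum_le_of_prod_one_add_le {ι : Type*} (S : Finset ι) {f : ι → ℝ}
    (hf : ∀ i ∈ S, 0 ≤ f i) {C : ℝ}
    (h : ∏ i ∈ S, (1 + f i) ≤ C) : ∑ i ∈ S, f i ≤ C := by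
  refine le_trans ?_ h
  have : 1 + ∑ i ∈ S, f i ≤ ∏ i ∈ S, (1 + f i) := by
    classical
    induction S using Finset.induction_on generalizing C with
    | empty => simp
    | insert i S hi ih =>
      have hf' : ∀ j ∈ S, 0 ≤ f j := fun j hj => hf j (Finset.mem_insert_of_mem hj)
      have h0 := hf i (Finset.mem_insert_self _ _)
      have h1 := ih hf' le_rfl
      have h2 := Finset.sum_nonneg hf'
      rw [Finset.sum_insert hi, Finset.prod_insert hi]
      nlinarith
  linarith

/-- A nonnegative multiplicative function is summable as soon as its values at prime powers are
summable, uniformly over finite sets of primes. -/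
lemma summable_of_sum_tsum_prime_pow_le {f : ℕ → ℝ} (hf : ∀ n, 0 ≤ f n) (h0 : f 0 = 0)
    (h1 : f 1 = 1) (hmul : ∀ {m n : ℕ}, m.Coprime n → f (m * n) = f m * f n)
    (hsum : ∀ {p : ℕ}, p.Prime → Summable fun k => f (p ^ (k + 1))) {K : ℝ}
    (hK : ∀ S : Finset ℕ, (∀ p ∈ S, p.Prime) → ∑ p ∈ S, ∑' k, f (p ^ (k + 1)) ≤ K) :
    Summable f := by
  have hsum' : ∀ {p : ℕ}, p.Prime → Summable fun k => f (p ^ k) := fun {p} hp =>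
    (summable_nat_add_iff (f := fun k => f (p ^ k)) 1).mp (hsum hp)
  refine summable_of_sum_le (c := Real.exp K) hf fun u => ?_
  set s := u.biUnion Nat.primeFactors with hs
  obtain ⟨hs1, hs2⟩ := EulerProduct.summable_and_hasSum_factoredNumbers_prod_filter_prime_tsum
    (f := f) h1 hmul (fun hp => (hsum' hp).norm) s
  have hsub : ∀ n ∈ u.erase 0, n ∈ Nat.factoredNumbers s := by
    intro n hn
    have hn' := Finset.mem_erase.mp hn
    exact Nat.mem_factoredNumbers_of_primeFactors_subset hn'.1
      (Finset.subset_biUnion_of_mem Nat.primeFactors hn'.2)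
  have e1 : ∑ n ∈ u, f n = ∑ n ∈ u.erase 0, f n := by
    refine (Finset.sum_subset (Finset.erase_subset 0 u) fun n hn hn' => ?_).symm
    have : n = 0 := by
      by_contra h
      exact hn' (Finset.mem_erase.mpr ⟨h, hn⟩)
    rw [this, h0]
  have e2 : ∑ n ∈ u.erase 0, f n ≤ ∏ p ∈ s with p.Prime, ∑' k, f (p ^ k) := by
    rw [← Finset.sum_subtype_of_mem f hsub]
    exact sum_le_hasSum _ (fun _ _ => hf _) hs2
  rw [e1]
  refine e2.trans ?_
  have hprime : ∀ p ∈ s.filter Nat.Prime, p.Prime := fun p hp => (Finset.mem_filter.mp hp).2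
  calc ∏ p ∈ s with p.Prime, ∑' k, f (p ^ k)
      = ∏ p ∈ s with p.Prime, (1 + ∑' k, f (p ^ (k + 1))) := by
        refine Finset.prod_congr rfl fun p hp => ?_
        rw [(hsum' (hprime p hp)).tsum_eq_zero_add, pow_zero, h1]
    _ ≤ Real.exp (∑ p ∈ s with p.Prime, ∑' k, f (p ^ (k + 1))) :=
        Real.prod_one_add_le_exp_sum _ fun p => tsum_nonneg fun k => hf _
    _ ≤ Real.exp K := Real.exp_le_exp.mpr (hK _ hprime)

lemma abscissaOfAbsConv_lt_top {a : ℕ → ℂ} (hconv : ∃ s l : ℂ, DirichletConvergesTo a s l) :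
    LSeries.abscissaOfAbsConv a < ⊤ := by
  obtain ⟨s, l, h⟩ := hconv
  have h0 : Tendsto (fun n => LSeries.term a s n) atTop (𝓝 0) := by
    have := ((tendsto_add_atTop_iff_nat 1).mpr h).sub h
    simpa [Finset.sum_range_succ] using this
  have hO : a =O[atTop] fun n : ℕ => (n : ℝ) ^ s.re := by
    refine Asymptotics.IsBigO.of_bound 1 ?_
    filter_upwards [(tendsto_zero_iff_norm_tendsto_zero.mp h0).eventually_le_const one_pos,
      eventually_gt_atTop 0] with n hn hn0
    have : (0 : ℝ) < (n : ℝ) ^ s.re := Real.rpow_pos_of_pos (by exact_mod_cast hn0) _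
    rw [LSeries.norm_term_eq, if_neg hn0.ne', div_le_one this] at hn
    rwa [one_mul, Real.norm_of_nonneg this.le]
  exact (LSeries.abscissaOfAbsConv_le_of_isBigO_rpow hO).trans_lt (EReal.coe_lt_top (s.re + 1))

/-- A Dirichlet series has a bounded analytic continuation to every closed half-plane of absolute
convergence. -/
lemma hasBoundedContinuation_of_abscissa_lt {a : ℕ → ℂ} {θ : ℝ}
    (h : LSeries.abscissaOfAbsConv a < θ) : HasBoundedContinuation a θ := by
  have hθ : LSeriesSummable a (θ : ℂ) := LSeriesSummable_of_abscissaOfAbsConv_lt_re (by simpa)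
  have hs : ∀ s : ℂ, θ ≤ s.re → LSeriesSummable a s := fun s hs => hθ.of_re_le_re (by simpa)
  refine ⟨LSeries a, fun s hs => LSeries_analyticOnNhd a s
    (h.trans_le (EReal.coe_le_coe_iff.mpr hs)), ⟨∑' n, ‖LSeries.term a θ n‖, fun s h => ?_⟩,
    fun s l h hl => tendsto_nhds_unique (hs s h).hasSum.tendsto_sum_nat hl⟩
  exact (norm_tsum_le_tsum_norm (hs s h).norm).trans ((hs s h).norm.tsum_le_tsum
    (fun n => LSeries.norm_term_le_of_re_le_re a (by simpa) n) hθ.norm)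

/-- A Dirichlet series with multiplicative coefficients converges absolutely to the right of any
half-plane to which it has a bounded analytic continuation. -/
lemma HasBoundedContinuation.lseriesSummable {a : ℕ → ℂ} (ha : MultiplicativeCoeffs a)
    (hconv : ∃ s l : ℂ, DirichletConvergesTo a s l) {θ : ℝ} (h : HasBoundedContinuation a θ)
    {ε : ℝ} (hε : 0 < ε) : LSeriesSummable a ((θ + ε : ℝ) : ℂ) := by
  have h11 : a 1 = a 1 * a 1 := ha 1 1 one_pos one_pos (Nat.coprime_one_left 1)
  rcases eq_or_ne (a 1) 0 with h1 | h1
  · have hz : ∀ n, LSeries.term a ((θ + ε : ℝ) : ℂ) n = 0 := by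
      intro n
      rcases Nat.eq_zero_or_pos n with rfl | hn
      · simp
      · have := ha n 1 hn one_pos (Nat.coprime_one_right n)
        rw [mul_one, h1, mul_zero] at this
        simp [LSeries.term_def, this]
    exact summable_zero.congr fun n => (hz n).symm ▸ rfl
  replace h1 : a 1 = 1 := (mul_right_cancel₀ h1 (by rw [one_mul, ← h11])).symm
  obtain ⟨F, han, ⟨C, hC⟩, hF⟩ := h
  obtain ⟨d, hd, -⟩ := EReal.lt_iff_exists_real_btwn.mp (abscissaOfAbsConv_lt_top hconv)
  have hs : LSeriesSummable a ((max θ d : ℝ) : ℂ) := LSeriesSummable_of_abscissaOfAbsConv_lt_re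
    (hd.trans_le (EReal.coe_le_coe_iff.mpr (by simp)))
  -- the bound for `k`-th powers of primes
  have hpow : ∀ (k : ℕ) (S : Finset ℕ), (∀ p ∈ S, p.Prime) →
      ∑ p ∈ S, ‖a (p ^ (k + 1))‖ * ((p ^ (k + 1) : ℕ) : ℝ) ^ (-θ) ≤ 2 * C := by
    intro k S hS
    have hinj : Set.InjOn (fun p : ℕ => p ^ (k + 1)) (S : Set ℕ) :=
      (Nat.pow_left_injective (Nat.succ_ne_zero k)).injOn
    have hb := prod_one_add_norm_le ha h1 han hC hF (le_max_left θ d) hs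
      (S := S.image fun p => p ^ (k + 1)) (by
        intro q hq
        obtain ⟨p, hp, rfl⟩ := Finset.mem_image.mp hq
        exact Nat.one_lt_pow (Nat.succ_ne_zero k) (hS p hp).one_lt) (by
        intro q hq r hr hqr
        obtain ⟨p, hp, rfl⟩ := Finset.mem_image.mp (Finset.mem_coe.mp hq)
        obtain ⟨p', hp', rfl⟩ := Finset.mem_image.mp (Finset.mem_coe.mp hr)
        refine Nat.Coprime.pow _ _ ((Nat.coprime_primes (hS p hp) (hS p' hp')).mpr ?_)
        rintro rfl
        exact hqr rfl)
    rw [Finset.prod_image hinj] at hb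
    have := sum_le_of_prod_one_add_le S (fun p _ => by positivity) hb
    rw [← Finset.sum_div] at this
    linarith
  set f : ℕ → ℝ := fun n => ‖LSeries.term a ((θ + ε : ℝ) : ℂ) n‖ with hfdef
  have hfpos : ∀ n, 0 < n → f n = ‖a n‖ * (n : ℝ) ^ (-θ) * (n : ℝ) ^ (-ε) := by
    intro n hn
    have hn' : (0 : ℝ) < n := by exact_mod_cast hn
    simp only [hfdef]
    rw [LSeries.norm_term_eq, if_neg hn.ne', Complex.ofReal_re, mul_assoc, ← Real.rpow_add hn',
      div_eq_mul_inv, ← Real.rpow_neg hn'.le]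
    ring_nf
  set ρ : ℝ := (2 : ℝ) ^ (-ε) with hρ
  have hρ0 : 0 ≤ ρ := by positivity
  have hρ1 : ρ < 1 := Real.rpow_lt_one_of_one_lt_of_neg one_lt_two (neg_lt_zero.mpr hε)
  have hfle : ∀ p k : ℕ, p.Prime → f (p ^ (k + 1)) ≤
      ‖a (p ^ (k + 1))‖ * ((p ^ (k + 1) : ℕ) : ℝ) ^ (-θ) * ρ ^ k := by
    intro p k hp
    rw [hfpos _ (pow_pos hp.pos _)]
    refine mul_le_mul_of_nonneg_left ?_ (by positivity)
    rw [hρ, ← Real.rpow_natCast, ← Real.rpow_mul zero_le_two, mul_comm, Real.rpow_mul zero_le_two,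
      Real.rpow_natCast]
    refine Real.rpow_le_rpow_of_nonpos (by positivity) ?_ (by linarith)
    have h2 : 2 ^ k ≤ p ^ (k + 1) :=
      (Nat.pow_le_pow_left hp.two_le k).trans (Nat.pow_le_pow_right hp.pos k.le_succ)
    exact_mod_cast h2
  have hsumf : ∀ S : Finset ℕ, (∀ p ∈ S, p.Prime) → ∀ k,
      ∑ p ∈ S, f (p ^ (k + 1)) ≤ 2 * C * ρ ^ k := by
    intro S hS k
    refine (Finset.sum_le_sum fun p hp => hfle p k (hS p hp)).trans ?_
    rw [← Finset.sum_mul]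
    exact mul_le_mul_of_nonneg_right (hpow k S hS) (by positivity)
  have hgeo : Summable fun k : ℕ => 2 * C * ρ ^ k :=
    (summable_geometric_of_lt_one hρ0 hρ1).mul_left _
  have hfn : ∀ n, 0 ≤ f n := fun n => norm_nonneg _
  have hsump : ∀ {p : ℕ}, p.Prime → Summable fun k => f (p ^ (k + 1)) := fun {p} hp =>
    hgeo.of_nonneg_of_le (fun k => hfn _) fun k => by simpa using hsumf {p} (by simpa using hp) k
  refine Summable.of_norm (summable_of_sum_tsum_prime_pow_le (f := f) hfn (by simp [hfdef]) ?_ ?_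
    hsump (K := ∑' k : ℕ, 2 * C * ρ ^ k) ?_)
  · simp [hfdef, LSeries.term_def, h1]
  · intro m n hmn
    rcases Nat.eq_zero_or_pos m with rfl | hm
    · simp [hfdef]
    rcases Nat.eq_zero_or_pos n with rfl | hn
    · simp [hfdef]
    rw [hfpos _ (Nat.mul_pos hm hn), hfpos _ hm, hfpos _ hn, ha m n hm hn hmn, norm_mul,
      Nat.cast_mul, Real.mul_rpow (Nat.cast_nonneg _) (Nat.cast_nonneg _),
      Real.mul_rpow (Nat.cast_nonneg _) (Nat.cast_nonneg _)]
    ring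
  · intro S hS
    rw [← Summable.tsum_finsetSum fun p hp => hsump (hS p hp)]
    exact (summable_sum fun p hp => hsump (hS p hp)).tsum_le_tsum (hsumf S hS) hgeo

lemma HasBoundedContinuation.abscissaOfAbsConv_le {a : ℕ → ℂ} (ha : MultiplicativeCoeffs a)
    (hconv : ∃ s l : ℂ, DirichletConvergesTo a s l) {θ : ℝ} (h : HasBoundedContinuation a θ) :
    LSeries.abscissaOfAbsConv a ≤ θ := by
  refine LSeries.abscissaOfAbsConv_le_of_forall_lt_LSeriesSummable' fun y hy => ?_
  have hy' : θ < y := EReal.coe_lt_coe_iff.mp hy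
  simpa using h.lseriesSummable ha hconv (ε := y - θ) (by linarith)

theorem mainTheorem3 (a : ℕ → ℂ) (ha : MultiplicativeCoeffs a)
    (hconv : ∃ s l : ℂ, DirichletConvergesTo a s l) :
    (∀ σ₀ : ℝ, (∀ ε : ℝ, 0 < ε → HasBoundedContinuation a (σ₀ + ε)) →
      LSeries.abscissaOfAbsConv a ≤ (σ₀ : EReal) ∧
      ((∀ θ : ℝ, θ < σ₀ → ¬ HasBoundedContinuation a θ) →
        LSeries.abscissaOfAbsConv a = (σ₀ : EReal))) ∧
    LSeries.abscissaOfAbsConv a = abscissaOfBoundedness a := by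
  refine ⟨fun σ₀ h => ?_, le_antisymm ?_ ?_⟩
  · have hle : LSeries.abscissaOfAbsConv a ≤ (σ₀ : EReal) := by
      refine EReal.le_of_forall_lt_iff_le.mp fun z hz => ?_
      have hz' : σ₀ < z := EReal.coe_lt_coe_iff.mp hz
      simpa using (h (z - σ₀) (by linarith)).abscissaOfAbsConv_le ha hconv
    refine ⟨hle, fun hmin => hle.antisymm (le_of_not_gt fun hlt => ?_)⟩
    obtain ⟨θ, h1, h2⟩ := EReal.lt_iff_exists_real_btwn.mp hlt
    exact hmin θ (EReal.coe_lt_coe_iff.mp h2) (hasBoundedContinuation_of_abscissa_lt h1)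
  · refine le_sInf ?_
    rintro _ ⟨θ, hθ, rfl⟩
    exact HasBoundedContinuation.abscissaOfAbsConv_le ha hconv hθ
  · exact EReal.le_of_forall_lt_iff_le.mp fun z hz =>
      sInf_le ⟨z, hasBoundedContinuation_of_abscissa_lt hz, rfl⟩
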